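/- Setting. There are goods (base arms) $\mathcal N=\{1,\dots,N\}$ with unknown qualities $\mu=(\mu_1,\dots,\mu_N)\in\mathbb R^N$, and agents $\mathcal K=\{1,\dots,K\}$. Agent $j$ has a family $\mathcal A_j\subseteq 2^{\mathcal N}$ of accessible bundles and a reward function $r^j(x;S)$ $(x\in\mathbb R^N, S\in\mathcal A_j)$. A set $\mathcal M^*$ of feasible matchings $\phi$ with $\phi(j)\in\mathcal A_j$ for all $j$, and for $\phi\in\mathcal M^*$ and a coalition $L\subseteq\mathcal K$ a set $\mathcal M^*|_{\phi,L}$ of deviating assignments $\phi'$ with $\phi'(j)\in\mathcal A_j$ for $j\in L$, are given arbitrarily; a *deviation* from $\phi$ is a pair $(L,\phi')$ with $1\le|L|\le\kappa$ and $\phi'\in\mathcal M^*|_{\phi,L}$. Put $$g^L(x;y;\phi\to\phi')=\max_{j\in L}\bigl(r^j(x;\phi(j))-r^j(y;\phi'(j))\bigr),\qquad g^L(\mu;\phi\to\phi')=g^L(\mu;\mu;\phi\to\phi'),$$ and let $\mathbb F(\mu,\eta)$ be the set of $\phi\in\mathcal M^*$ with $g^L(\mu;\phi\to\phi')\ge\eta$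 for all deviations $(L,\phi')$ from $\phi$ (the $\eta$-stable matchings). Feasibility ULCB, with parameters $\alpha>2$, $\sigma>0$, $\eta$, $\epsilon$. In round $t$ each pulled arm $i$ shows $X_i(t)=\mu_i+\xi_i(t)$, where the noise vectors $\xi(t)$ are independent across $t$ and each $\xi_i(t)$ is $\sigma^2$-subgaussian with mean $0$. In rounds $1,\dots,N$ each arm is pulled once (and an arbitrary matching $\phi_t$ is output). In round $t>N$, let $T_i(t-1)$ be the number of earlier pulls of arm $i$, $\hat\mu_i(t)$ the average of the rewards observed at these pulls, and $$\bar\nu_i(t),\ \underline\nu_i(t)=\hat\mu_i(t)\pm\sqrt{\tfrac{1}{T_i(t-1)}\,2\sigma^2\log t^\alpha}.$$ An oracle, which is a measurable function of $(\underline\nu(t),\bar\nu(t))$, returns $(\delta_t,\phi_t,L_t,\phi_t')$ as follows. If some $\phi\in\mathcal M^*$ has $g^L(\underline\nu(t);\bar\nu(t);\phi\to\phi')\ge\epsilon$ for all its deviations, then $\delta_t=1$ and $\phi_t$ is such a matching (and $L_t,\phi'_t$ are arbitrary). Otherwise $\delta_t=0$; $\phi_t\in\mathcal M^*$ is a matching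 with $g^L(\bar\nu(t);\underline\nu(t);\phi_t\to\phi')\ge\eta$ for all its deviations if there is one, and arbitrary in $\mathcal M^*$ if there is none; and $(L_t,\phi'_t)$ is a deviation from $\phi_t$ with $g^{L_t}(\underline\nu(t);\bar\nu(t);\phi_t\to\phi_t')<\epsilon$. The algorithm outputs $\phi_t$ and pulls the arms in $\phi_t(j)\cup\phi'_t(j)$, $j\in L_t$. Assumptions. (1) For some $c>0$, all $j$, $S\in\mathcal A_j$ and $x,y\in\mathbb R^N$: $|r^j(x;S)-r^j(y;S)|\le c\sum_{i\in S}|x_i-y_i|$, and $r^j(x;S)\le r^j(y;S)$ if $x_i\le y_i$ for all $i\in S$. (2) $\eta>0$ and $\Delta>0$ are such that $\eta-g^L(\mu;\phi\to\phi')\ge\Delta$ for all $\phi\in\mathcal M^*\setminus\mathbb F(\mu,\eta)$ and all deviations $(L,\phi')$ from $\phi$ with $g^L(\mu;\phi\to\phi')<\eta$; and $\eta-\Delta<\epsilon<\eta$. (3) $\mathbb F(\mu,\eta)\neq\emptyset$. Theorem. There are quantities $\tilde C_1(\alpha,c,\sigma)$ and $\tilde C_2(\alpha)$, depending on nothing else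 (in particular not on $N$ and $T$), such that in this setting, for every $T>N$, $$R_T:=\mathbb E\Bigl[\sum_{t=1}^T\mathbf 1\{\phi_t\notin\mathbb F(\mu,\eta)\}\Bigr]\le \tilde C_1(\alpha,c,\sigma)\bigl(\Delta^{-2}+(\eta-\epsilon)^{-2}\bigr)N^3\log T+N\,\tilde C_2(\alpha).$$ -/

import Mathlib

open MeasureTheory ProbabilityTheory

noncomputable section

namespace FeasibilityULCB

/-- An assignment of bundles of the goods `Fin N` to the agents `Fin K`. -/
abbrev Assignment (N K : ℕ) : Type := Fin K → Finset (Fin N)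

/-- A stable assignment problem with `N` goods (base arms) and `K` agents. -/
structure Model (N K : ℕ) where
  /-- `bundles j` is the family of bundles accessible to agent `j`. -/
  bundles : Fin K → Set (Finset (Fin N))
  /-- `reward j x S` is the reward of agent `j` for the bundle `S` when the vector of qualities is
  `x`; only its values at accessible bundles matter. -/
  reward : Fin K → (Fin N → ℝ) → Finset (Fin N) → ℝ
  /-- The set of feasible assignments (matchings). -/
  feasible : Set (Assignment N K)
  feasible_mem : ∀ φ ∈ feasible, ∀ j, φ j ∈ bundles j
  /-- The largest size of a deviating coalition. -/
  κ : ℕ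
  /-- `deviations φ L` is the set of deviating assignments of the coalition `L` from `φ`. -/
  deviations : Assignment N K → (L : Finset (Fin K)) → Set (L → Finset (Fin N))
  deviations_mem : ∀ φ ∈ feasible, ∀ L, ∀ φ' ∈ deviations φ L, ∀ j : L, φ' j ∈ bundles j

variable {N K : ℕ}

namespace Model

/-- `(L, φ')` is a possible deviation from `φ`: a nonempty coalition of at most `κ` agents with one
of its deviating assignments. -/
def IsDeviation (M : Model N K) (φ : Assignment N K) (L : Finset (Fin K))
    (φ' : L → Finset (Fin N)) : Prop :=
  L.Nonempty ∧ L.card ≤ M.κ ∧ φ' ∈ M.deviations φ L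

/-- The benefit `max_{j ∈ L} (r^j(x, φ(j)) - r^j(y, φ'(j)))` of the (nonempty) coalition `L` from
staying at `φ`, where `φ` is evaluated at `x` and the deviation `φ'` at `y`. The true benefit is the
case `x = y = μ`; the upper estimate is the case where `x` is the vector of upper and `y` that of
lower confidence bounds, the lower estimate the opposite case. -/
def benefit (M : Model N K) (x y : Fin N → ℝ) (φ : Assignment N K) (L : Finset (Fin K))
    (φ' : L → Finset (Fin N)) : ℝ :=
  ⨆ j : L, (M.reward j x (φ j) - M.reward j y (φ' j))

/-- `φ` is feasible, and its benefit over each deviation, computed from `x` and `y`, is at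
least `θ`. -/
def StableAt (M : Model N K) (x y : Fin N → ℝ) (θ : ℝ) (φ : Assignment N K) : Prop :=
  φ ∈ M.feasible ∧
    ∀ (L : Finset (Fin K)) (φ' : L → Finset (Fin N)), M.IsDeviation φ L φ' →
      θ ≤ M.benefit x y φ L φ'

/-- The set of `θ`-stable matchings for the qualities `μ`. -/
def stableSet (M : Model N K) (μ : Fin N → ℝ) (θ : ℝ) : Set (Assignment N K) :=
  {φ | M.StableAt μ μ θ φ}

/-- The rewards of accessible bundles are Lipschitz with constant `c` and monotone in the qualities
of the goods of the bundle. -/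
def RewardRegular (M : Model N K) (c : ℝ) : Prop :=
  ∀ j, ∀ S ∈ M.bundles j, ∀ x y : Fin N → ℝ,
    |M.reward j x S - M.reward j y S| ≤ c * ∑ i ∈ S, |x i - y i| ∧
      ((∀ i ∈ S, x i ≤ y i) → M.reward j x S ≤ M.reward j y S)

/-- The gap condition: each deviation from a feasible matching that is not `η`-stable has a benefit
that is either at least `η` or at most `η - Δ`. -/
def Separated (M : Model N K) (μ : Fin N → ℝ) (η Δ : ℝ) : Prop :=
  ∀ φ ∈ M.feasible, φ ∉ M.stableSet μ η →
    ∀ (L : Finset (Fin K)) (φ' : L → Finset (Fin N)), M.IsDeviation φ L φ' →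
      M.benefit μ μ φ L φ' < η → Δ ≤ η - M.benefit μ μ φ L φ'

/-- The decision rule, for the vectors `lo` and `up` of lower and upper confidence bounds: some
matching has lower estimates of its benefits that are all at least `ε`. -/
def Accepts (M : Model N K) (ε : ℝ) (lo up : Fin N → ℝ) : Prop :=
  ∃ φ, M.StableAt lo up ε φ

end Model

/-- What the oracle returns: a decision (`true` stands for `1`), a matching `φ`, a coalition `L` and
an assignment `φ'` of bundles to its members. -/
structure OracleOutput (N K : ℕ) where
  decision : Bool
  matching : Assignment N K
  group : Finset (Fin K)
  deviation : group → Finset (Fin N)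

/-- An oracle receives the vectors of lower and of upper confidence bounds, in this order. -/
abbrev Oracle (N K : ℕ) : Type := (Fin N → ℝ) → (Fin N → ℝ) → OracleOutput N K

/-- The specification of the oracle. If the decision is `1`, it returns a matching all of whose lower
estimates are at least `ε` (and any coalition and assignment). If the decision is `0`, it returns a
matching all of whose upper estimates are at least `η` if there is one, and any feasible matching
otherwise, together with a deviation from this matching whose lower estimate is less than `ε`. -/
def IsFeasibilityOracle (M : Model N K) (η ε : ℝ) (O : Oracle N K) : Prop :=
  ∀ lo up : Fin N → ℝ,
    ((O lo up).decision = true ↔ M.Accepts ε lo up) ∧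
    (M.Accepts ε lo up → M.StableAt lo up ε (O lo up).matching) ∧
    (¬ M.Accepts ε lo up →
      (O lo up).matching ∈ M.feasible ∧
      ((∃ φ, M.StableAt up lo η φ) → M.StableAt up lo η (O lo up).matching) ∧
      M.IsDeviation (O lo up).matching (O lo up).group (O lo up).deviation ∧
      M.benefit lo up (O lo up).matching (O lo up).group (O lo up).deviation < ε)

/-- Measurability of the oracle (which takes finitely many values). -/
def MeasurableOracle (O : Oracle N K) : Prop :=
  ∀ o : OracleOutput N K, MeasurableSet {p : (Fin N → ℝ) × (Fin N → ℝ) | O p.1 p.2 = o}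

/-- The statistics kept by the algorithm: for each arm, the number of its pulls and the sum of the
rewards observed at these pulls. -/
structure Stats (N : ℕ) where
  count : Fin N → ℕ
  total : Fin N → ℝ

/-- The radius of the confidence interval of arm `i` in round `t`, where `s` holds the statistics of
the rounds before `t`. -/
def radius (σ α : ℝ) (t : ℕ) (s : Stats N) (i : Fin N) : ℝ :=
  Real.sqrt (1 / (s.count i : ℝ) * (2 * σ ^ 2 * Real.log ((t : ℝ) ^ α)))

/-- The upper confidence bounds in round `t`. -/
def ucb (σ α : ℝ) (t : ℕ) (s : Stats N) (i : Fin N) : ℝ :=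
  s.total i / (s.count i : ℝ) + radius σ α t s i

/-- The lower confidence bounds in round `t`. -/
def lcb (σ α : ℝ) (t : ℕ) (s : Stats N) (i : Fin N) : ℝ :=
  s.total i / (s.count i : ℝ) - radius σ α t s i

/-- What the oracle returns in round `t`, where `s` holds the statistics of the rounds before `t`. -/
def oracleAnswer (O : Oracle N K) (σ α : ℝ) (t : ℕ) (s : Stats N) : OracleOutput N K :=
  O (lcb σ α t s) (ucb σ α t s)

/-- The arms pulled in round `t`: each arm once in the rounds `1, ..., N`; afterwards the arms in the
bundles `φ(j)` and `φ'(j)` for the members `j` of the coalition returned by the oracle. -/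
def pulls (O : Oracle N K) (σ α : ℝ) (t : ℕ) (s : Stats N) : Finset (Fin N) :=
  if t ≤ N then Finset.univ.filter (fun i : Fin N => (i : ℕ) + 1 = t)
  else (oracleAnswer O σ α t s).group.attach.biUnion
    (fun j => (oracleAnswer O σ α t s).matching j ∪ (oracleAnswer O σ α t s).deviation j)

/-- The statistics after round `t`, when pulling arm `i` in round `t` shows the reward `X t i`. -/
def stats (O : Oracle N K) (σ α : ℝ) (X : ℕ → Fin N → ℝ) : ℕ → Stats N
  | 0 => ⟨fun _ => 0, fun _ => 0⟩
  | t + 1 =>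
    let s := stats O σ α X t
    let P := pulls O σ α (t + 1) s
    ⟨fun i => s.count i + (if i ∈ P then 1 else 0),
      fun i => s.total i + (if i ∈ P then X (t + 1) i else 0)⟩

/-- The matching output in round `t ≥ 1`: in the rounds `1, ..., N` an arbitrary one, given by
`init`; afterwards the one returned by the oracle. -/
def output (O : Oracle N K) (σ α : ℝ) (init : ℕ → Assignment N K) (X : ℕ → Fin N → ℝ) (t : ℕ) :
    Assignment N K :=
  if t ≤ N then init t else (oracleAnswer O σ α t (stats O σ α X (t - 1))).matching

/-- The regret: the expected number of rounds `t ∈ {1, ..., T}` whose output lies outside `F`, when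
the observed rewards are `X_i(t) = μ_i + ξ_i(t)`. -/
def regret {Ω : Type*} [MeasurableSpace Ω] (P : Measure Ω) (O : Oracle N K) (σ α : ℝ)
    (init : ℕ → Assignment N K) (μ : Fin N → ℝ) (ξ : ℕ → Ω → Fin N → ℝ)
    (F : Set (Assignment N K)) (T : ℕ) : ENNReal :=
  ∫⁻ ω, ∑ t ∈ Finset.Icc 1 T,
    Set.indicator {ω' | output O σ α init (fun s i => μ i + ξ s ω' i) t ∉ F} 1 ω ∂P

end FeasibilityULCB

end

/-! The number of unstable outputs is controlled by splitting rounds according to whether every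
confidence interval contains the true quality.

If all intervals are correct, an unstable output carries information. It cannot come from an
acceptance: its true benefits would be at least `ε > η - Δ`, and the gap condition would lift them
to `η`. After a rejection, a truly stable matching passes the optimistic test, so the returned
matching passes it too. Its returned deviation then has upper estimate at least `η` and lower
estimate below `ε`. By the Lipschitz condition the pulled intervals have total width above `(η - ε)
/ (2c)` (`Model.lt_of_oracle_notMem`), so some pulled arm has a wide interval, hence only `O(N² log
T / (η - ε)²)` observations. Each arm can be charged in this way only that often (`sum_pulls_le`),
which gives the `N³ log T` term.

Incorrect intervals are rare although pulls are adaptive. For fixed `λ` the exponential weight of an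
arm's accumulated noise is a supermartingale, because the decision to pull depends only on the past
(`lintegral_expWeight_le`). Markov's inequality and a union over the possible pull counts bound a
miss in round `t` by `2 t^(1 - α)` (`measure_misses_le`), summable since `α > 2`. -/

namespace FeasibilityULCB

variable {N K : ℕ}

/-! ### Benefits under confidence bounds. -/

namespace Model

variable {M : Model N K} {c : ℝ}

/-- The benefit is monotone in the qualities used for the current matching and antitone in those
used for the deviation. -/
theorem benefit_mono (hM : M.RewardRegular c) {x x' y y' : Fin N → ℝ} (hx : x ≤ x') (hy : y' ≤ y)
    {φ : Assignment N K} (hφ : φ ∈ M.feasible) {L : Finset (Fin K)} {φ' : L → Finset (Fin N)}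
    (hd : M.IsDeviation φ L φ') : M.benefit x y φ L φ' ≤ M.benefit x' y' φ L φ' := by
  refine ciSup_mono (Set.finite_range _).bddAbove fun j => ?_
  have h₁ := (hM j _ (M.feasible_mem φ hφ j) x x').2 fun i _ => hx i
  have h₂ := (hM j _ (M.deviations_mem φ hφ L φ' hd.2.2 j) y' y).2 fun i _ => hy i
  linarith

theorem StableAt.mono (hM : M.RewardRegular c) {x x' y y' : Fin N → ℝ} (hx : x ≤ x') (hy : y' ≤ y)
    {θ : ℝ} {φ : Assignment N K} (h : M.StableAt x y θ φ) : M.StableAt x' y' θ φ :=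
  ⟨h.1, fun L φ' hd => (h.2 L φ' hd).trans (benefit_mono hM hx hy h.1 hd)⟩

/-- The upper and the lower estimate of a benefit differ by at most a multiple of the total width
of the confidence intervals of the goods involved. -/
theorem benefit_sub_le (hM : M.RewardRegular c) (hc : 0 < c) {lo up : Fin N → ℝ} (hle : lo ≤ up)
    {φ : Assignment N K} (hφ : φ ∈ M.feasible) {L : Finset (Fin K)} {φ' : L → Finset (Fin N)}
    (hd : M.IsDeviation φ L φ') :
    M.benefit up lo φ L φ' ≤ M.benefit lo up φ L φ' +
      2 * c * ∑ i ∈ L.attach.biUnion (fun j => φ j ∪ φ' j), (up i - lo i) := by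
  have : Nonempty L := hd.1.to_subtype
  have hnn : ∀ i, 0 ≤ up i - lo i := fun i => sub_nonneg.2 (hle i)
  refine ciSup_le fun j => ?_
  have hsub : φ j ∪ φ' j ⊆ L.attach.biUnion (fun j => φ j ∪ φ' j) :=
    Finset.subset_biUnion_of_mem (fun j : L => φ j ∪ φ' j) (Finset.mem_attach L j)
  have bound : ∀ S ∈ M.bundles j, S ⊆ φ j ∪ φ' j → M.reward j up S - M.reward j lo S ≤
      c * ∑ i ∈ L.attach.biUnion (fun j => φ j ∪ φ' j), (up i - lo i) := by
    intro S hS hSub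
    refine (le_abs_self _).trans ((hM j S hS up lo).1.trans ?_)
    refine mul_le_mul_of_nonneg_left ?_ hc.le
    refine (Finset.sum_congr rfl fun i _ => abs_of_nonneg (hnn i)).trans_le ?_
    exact Finset.sum_le_sum_of_subset_of_nonneg (hSub.trans hsub) fun i _ _ => hnn i
  have h₁ := bound _ (M.feasible_mem φ hφ j) Finset.subset_union_left
  have h₂ := bound _ (M.deviations_mem φ hφ L φ' hd.2.2 j) Finset.subset_union_right
  have h₃ : M.reward j lo (φ j) - M.reward j up (φ' j) ≤ M.benefit lo up φ L φ' :=
    le_ciSup (f := fun j : L => M.reward j lo (φ j) - M.reward j up (φ' j))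
      (Set.finite_range _).bddAbove j
  linarith

/-- If the confidence bounds are correct but the oracle returns a matching that is not `η`-stable,
then the intervals of the goods in the returned bundles are wide in total. -/
theorem lt_of_oracle_notMem (hM : M.RewardRegular c) (hc : 0 < c) {μ : Fin N → ℝ} {η ε Δ : ℝ}
    (hsep : M.Separated μ η Δ) (hΔ : η - Δ < ε) (hne : (M.stableSet μ η).Nonempty)
    {O : Oracle N K} (hO : IsFeasibilityOracle M η ε O) {lo up : Fin N → ℝ} (hlo : lo ≤ μ)
    (hup : μ ≤ up) (hout : (O lo up).matching ∉ M.stableSet μ η) :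
    η - ε < 2 * c * ∑ i ∈ (O lo up).group.attach.biUnion
      (fun j => (O lo up).matching j ∪ (O lo up).deviation j), (up i - lo i) := by
  obtain ⟨-, hacc, hrej⟩ := hO lo up
  -- Lower estimates of at least `ε` pass to the true benefits. A true benefit below `η` would be at
  -- most `η - Δ < ε` by the gap condition, so acceptance would certify stability.
  have hna : ¬ M.Accepts ε lo up := by
    intro ha
    have hs := (hacc ha).mono hM hlo hup
    refine hout ⟨hs.1, fun L φ' hd => ?_⟩
    by_contra! hlt
    linarith [hsep _ hs.1 hout L φ' hd hlt, hs.2 L φ' hd]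
  obtain ⟨hf, hst, hd, hlt⟩ := hrej hna
  obtain ⟨φ, hφ⟩ := hne
  -- A truly stable matching witnesses that the optimistic test can be passed, so the returned
  -- matching passes it as well.
  have h := (hst ⟨φ, StableAt.mono hM hup hlo hφ⟩).2 _ _ hd
  linarith [benefit_sub_le hM hc (hlo.trans hup) hf hd]

end Model

/-- A sum of at most `N` terms exceeds `N` times some term's bound only if a term does. -/
theorem exists_div_lt_of_lt_sum {P : Finset (Fin N)} {f : Fin N → ℝ} {a b : ℝ} (ha : 0 < a)
    (hb : 0 < b) (h : a < b * ∑ i ∈ P, f i) : ∃ i ∈ P, a / (b * N) < f i := by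
  by_contra! hcon
  have hs : ∑ i ∈ P, f i ≤ N * (a / (b * N)) := by
    refine (Finset.sum_le_card_nsmul P f _ hcon).trans ?_
    rw [nsmul_eq_mul]
    refine mul_le_mul_of_nonneg_right ?_ (by positivity)
    exact_mod_cast (Finset.card_le_univ P).trans_eq (Fintype.card_fin N)
  -- For `N = 0` the threshold `a / (b * N)` is `0` by convention, and a nonpositive sum already
  -- contradicts `0 < a`.
  rcases Nat.eq_zero_or_pos N with hN | hN
  · have hs' : ∑ i ∈ P, f i ≤ 0 := by simpa [hN] using hs
    nlinarith
  · have hN' : (0 : ℝ) < N := by exact_mod_cast hN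
    have : b * (N * (a / (b * N))) = a := by field_simp
    nlinarith [mul_le_mul_of_nonneg_left hs hb.le]

/-! ### Pull counts along a sample path. -/

variable {O : Oracle N K} {σ α : ℝ}

theorem stats_count_succ (X : ℕ → Fin N → ℝ) (t : ℕ) (i : Fin N) :
    (stats O σ α X (t + 1)).count i = (stats O σ α X t).count i +
      if i ∈ pulls O σ α (t + 1) (stats O σ α X t) then 1 else 0 := rfl

theorem stats_total_succ (X : ℕ → Fin N → ℝ) (t : ℕ) (i : Fin N) :
    (stats O σ α X (t + 1)).total i = (stats O σ α X t).total i +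
      if i ∈ pulls O σ α (t + 1) (stats O σ α X t) then X (t + 1) i else 0 := rfl

theorem stats_count_le (X : ℕ → Fin N → ℝ) (t : ℕ) (i : Fin N) :
    (stats O σ α X t).count i ≤ t := by
  induction t with
  | zero => exact le_rfl
  | succ t ih => rw [stats_count_succ]; split_ifs <;> omega

theorem stats_count_of_le (X : ℕ → Fin N → ℝ) {t : ℕ} (ht : t ≤ N) (i : Fin N) :
    (stats O σ α X t).count i = if (i : ℕ) + 1 ≤ t then 1 else 0 := by
  induction t with
  | zero => simp [stats]
  | succ t ih =>
    rw [stats_count_succ, ih (by omega), pulls, if_pos ht]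
    simp only [Finset.mem_filter_univ]
    split_ifs <;> omega

/-- The initial rounds supply one observation of each arm, so later averages and radii never divide
by zero. -/
theorem one_le_stats_count (X : ℕ → Fin N → ℝ) {t : ℕ} (ht : N ≤ t) (i : Fin N) :
    1 ≤ (stats O σ α X t).count i := by
  induction t, ht using Nat.le_induction with
  | base => rw [stats_count_of_le X le_rfl, if_pos (show (i : ℕ) + 1 ≤ N from i.isLt)]
  | succ t _ ih => rw [stats_count_succ]; omega

open Classical in
/-- After the initial rounds, an arm is pulled at most `B` times while its count is at most `B`. -/
theorem sum_pulls_le (X : ℕ → Fin N → ℝ) (i : Fin N) {B : ℝ} (hB : 0 ≤ B) {T : ℕ} (hT : N ≤ T) :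
    (∑ t ∈ Finset.Ioc N T, if i ∈ pulls O σ α t (stats O σ α X (t - 1)) ∧
      ((stats O σ α X (t - 1)).count i : ℝ) ≤ B then (1 : ℝ) else 0) ≤ B := by
  -- The induction also carries that the count exceeds the sum by at least one, thanks to the
  -- initial pull. A new charged pull therefore finds sum `+ 1 ≤` count `≤ B`, and the increased sum
  -- still fits under `B`.
  suffices h : (∑ t ∈ Finset.Ioc N T, if i ∈ pulls O σ α t (stats O σ α X (t - 1)) ∧
      ((stats O σ α X (t - 1)).count i : ℝ) ≤ B then (1 : ℝ) else 0) + 1 ≤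
      (stats O σ α X T).count i ∧ (∑ t ∈ Finset.Ioc N T,
        if i ∈ pulls O σ α t (stats O σ α X (t - 1)) ∧
      ((stats O σ α X (t - 1)).count i : ℝ) ≤ B then (1 : ℝ) else 0) ≤ B from h.2
  induction T, hT using Nat.le_induction with
  | base => simpa using ⟨one_le_stats_count X le_rfl i, hB⟩
  | succ T hT ih =>
    rw [Finset.sum_Ioc_succ_top (by omega), stats_count_succ, Nat.add_sub_cancel]
    obtain ⟨h₁, h₂⟩ := ih
    by_cases hp : i ∈ pulls O σ α (T + 1) (stats O σ α X T)
    · by_cases hc : ((stats O σ α X T).count i : ℝ) ≤ B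
      · simp only [hp, hc, and_self, if_true]
        push_cast
        constructor <;> linarith
      · simp only [hp, hc, and_false, if_true, if_false]
        push_cast
        constructor <;> linarith
    · simp only [hp, false_and, if_false, add_zero]
      exact ⟨h₁, h₂⟩

/-- A wide confidence interval belongs to an arm with few pulls. -/
theorem count_le_of_lt_radius {t T : ℕ} (ht : 1 ≤ t) (htT : t ≤ T) (hα : 0 ≤ α) {s : Stats N}
    {i : Fin N} (hs : 1 ≤ s.count i) {δ : ℝ} (hδ : 0 < δ) (h : δ < radius σ α t s i) :
    (s.count i : ℝ) ≤ 2 * σ ^ 2 * α * Real.log T / δ ^ 2 := by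
  have ht' : (0 : ℝ) < t := by exact_mod_cast ht
  have hn : (0 : ℝ) < s.count i := by exact_mod_cast hs
  rw [radius, Real.lt_sqrt hδ.le, Real.log_rpow ht', one_div, ← div_eq_inv_mul, lt_div_iff₀ hn] at h
  rw [le_div_iff₀ (by positivity)]
  have hlog : Real.log t ≤ Real.log T := Real.log_le_log ht' (by exact_mod_cast htT)
  have : 2 * σ ^ 2 * α * Real.log t ≤ 2 * σ ^ 2 * α * Real.log T :=
    mul_le_mul_of_nonneg_left hlog (by positivity)
  linarith

end FeasibilityULCB

/-! ### Measurability of the history. -/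

namespace FeasibilityULCB

variable {N K : ℕ} {O : Oracle N K} {σ α : ℝ}

/-- Finiteness lets any event about the oracle's answer be written as a countable union of its
measurable fibres. -/
instance : Finite (OracleOutput N K) :=
  Finite.of_injective
    (fun o : OracleOutput N K => (⟨o.group, o.decision, o.matching, o.deviation⟩ :
      Σ L : Finset (Fin K), Bool × Assignment N K × (L → Finset (Fin N)))) fun a b h => by
    cases a; cases b
    simp only [Sigma.mk.injEq] at h
    obtain ⟨rfl, h⟩ := h
    simp_all

theorem measurable_radius {Ω : Type*} [MeasurableSpace Ω] {S : Ω → Stats N} {i : Fin N}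
    (hc : Measurable fun ω => (S ω).count i) (t : ℕ) :
    Measurable fun ω => radius σ α t (S ω) i :=
  ((measurable_const.div (measurable_from_top.comp hc)).mul_const _).sqrt

/-- Each event about the oracle's answer is measurable if the statistics are. -/
theorem measurableSet_oracleAnswer {Ω : Type*} [MeasurableSpace Ω] (hO : MeasurableOracle O)
    {S : Ω → Stats N} (hc : ∀ i, Measurable fun ω => (S ω).count i)
    (ht : ∀ i, Measurable fun ω => (S ω).total i) (t : ℕ) (p : OracleOutput N K → Prop) :
    MeasurableSet {ω | p (oracleAnswer O σ α t (S ω))} := by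
  have hc' : ∀ i, Measurable fun ω => ((S ω).count i : ℝ) := fun i =>
    measurable_from_top.comp (hc i)
  have hr : ∀ i, Measurable fun ω => radius σ α t (S ω) i := fun i =>
    measurable_radius (hc i) t
  have hlo : Measurable fun ω => lcb σ α t (S ω) :=
    measurable_pi_lambda _ fun i => ((ht i).div (hc' i)).sub (hr i)
  have hup : Measurable fun ω => ucb σ α t (S ω) :=
    measurable_pi_lambda _ fun i => ((ht i).div (hc' i)).add (hr i)
  have : {ω | p (oracleAnswer O σ α t (S ω))} =
      ⋃ o ∈ {o | p o}, {ω | O (lcb σ α t (S ω)) (ucb σ α t (S ω)) = o} := by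
    ext ω
    simp [oracleAnswer]
  rw [this]
  exact MeasurableSet.biUnion (Set.to_countable _) fun o _ => (hlo.prodMk hup) (hO o)

theorem measurableSet_mem_pulls {Ω : Type*} [MeasurableSpace Ω] (hO : MeasurableOracle O)
    {S : Ω → Stats N} (hc : ∀ i, Measurable fun ω => (S ω).count i)
    (ht : ∀ i, Measurable fun ω => (S ω).total i) (t : ℕ) (i : Fin N) :
    MeasurableSet {ω | i ∈ pulls O σ α t (S ω)} := by
  unfold pulls
  split_ifs
  · exact MeasurableSet.const _
  · exact measurableSet_oracleAnswer hO hc ht t fun o =>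
      i ∈ o.group.attach.biUnion fun j => o.matching j ∪ o.deviation j

/-- The statistics after round `t` are measurable functions of the rewards of the rounds up
to `t`. -/
theorem measurable_stats {Ω : Type*} [MeasurableSpace Ω] (hO : MeasurableOracle O)
    {X : ℕ → Ω → Fin N → ℝ} {t : ℕ} (hX : ∀ s ≤ t, Measurable (X s)) :
    (∀ i, Measurable fun ω => (stats O σ α (fun s => X s ω) t).count i) ∧
      ∀ i, Measurable fun ω => (stats O σ α (fun s => X s ω) t).total i := by
  induction t with
  | zero => exact ⟨fun i => measurable_const, fun i => measurable_const⟩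
  | succ t ih =>
    obtain ⟨hc, ht⟩ := ih fun s hs => hX s (by omega)
    have hp := fun i => measurableSet_mem_pulls (σ := σ) (α := α) hO hc ht (t + 1) i
    refine ⟨fun i => (hc i).add (Measurable.ite (hp i) measurable_const measurable_const),
      fun i => (ht i).add (Measurable.ite (hp i) ?_ measurable_const)⟩
    exact (measurable_pi_apply i).comp (hX (t + 1) le_rfl)

/-! ### The exponential supermartingale. -/

/-- The exponential weight of the accumulated noise of arm `i`, whose quality is `m`. -/
noncomputable def expWeight (σ lam m : ℝ) (i : Fin N) (s : Stats N) : ENNReal :=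
  ENNReal.ofReal (Real.exp
    (lam * (s.total i - s.count i * m) - lam ^ 2 * σ ^ 2 / 2 * s.count i))

theorem measurable_expWeight {Ω : Type*} [MeasurableSpace Ω] {S : Ω → Stats N} {i : Fin N}
    (hc : Measurable fun ω => (S ω).count i) (ht : Measurable fun ω => (S ω).total i)
    (lam m : ℝ) : Measurable fun ω => expWeight σ lam m i (S ω) := by
  have hc' : Measurable fun ω => ((S ω).count i : ℝ) := measurable_from_top.comp hc
  unfold expWeight
  fun_prop

section Supermartingale

variable {Ω : Type*} [mΩ : MeasurableSpace Ω] {P : Measure Ω} {ξ : ℕ → Ω → Fin N → ℝ}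

/-- The term `lam ^ 2 * σ ^ 2 / 2` is exactly the subgaussian bound on the logarithm of the moment
generating function. -/
theorem lintegral_exp_noise_le [IsProbabilityMeasure P] {Y : Ω → ℝ}
    (hY : HasSubgaussianMGF Y (Real.toNNReal (σ ^ 2)) P) (lam : ℝ) :
    ∫⁻ ω, ENNReal.ofReal (Real.exp (lam * Y ω - lam ^ 2 * σ ^ 2 / 2)) ∂P ≤ 1 := by
  have hint : Integrable (fun ω => Real.exp (lam * Y ω - lam ^ 2 * σ ^ 2 / 2)) P := by
    simp_rw [Real.exp_sub]
    exact (hY.integrable_exp_mul lam).div_const _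
  rw [← ofReal_integral_eq_lintegral_ofReal hint (ae_of_all _ fun _ => (Real.exp_pos _).le),
    ENNReal.ofReal_le_one]
  simp_rw [Real.exp_sub]
  rw [integral_div, div_le_one (Real.exp_pos _)]
  refine (hY.mgf_le lam).trans_eq ?_
  rw [Real.coe_toNNReal _ (sq_nonneg σ), mul_comm (σ ^ 2)]

/-- The exponential weights form a supermartingale with initial value `1`. -/
theorem lintegral_expWeight_le [IsProbabilityMeasure P] (hO : MeasurableOracle O)
    (hξ : ∀ t, Measurable (ξ t)) (hind : iIndepFun ξ P)
    (hsub : ∀ t i, HasSubgaussianMGF (fun ω => ξ t ω i) (Real.toNNReal (σ ^ 2)) P)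
    (μ : Fin N → ℝ) (lam : ℝ) (i : Fin N) (t : ℕ) :
    ∫⁻ ω, expWeight σ lam (μ i) i (stats O σ α (fun s i => μ i + ξ s ω i) t) ∂P ≤ 1 := by
  induction t with
  | zero => simp [stats, expWeight]
  | succ t ih =>
    let S : Ω → Stats N := fun ω => stats O σ α (fun s i => μ i + ξ s ω i) t
    let Z : Ω → ENNReal := fun ω => expWeight σ lam (μ i) i (S ω)
    let W : Ω → ENNReal := fun ω =>
      ENNReal.ofReal (Real.exp (lam * ξ (t + 1) ω i - lam ^ 2 * σ ^ 2 / 2))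
    let A : Set Ω := {ω | i ∈ pulls O σ α (t + 1) (S ω)}
    -- `ℱ I` is generated by the noise of the rounds in `I`; the past `Set.Iic t` and the next round
    -- `{t + 1}` are independent.
    let ℱ : Set ℕ → MeasurableSpace Ω := fun I =>
      ⨆ s ∈ I, (inferInstance : MeasurableSpace (Fin N → ℝ)).comap (ξ s)
    have hℱ : ∀ I, ℱ I ≤ mΩ := fun I => iSup₂_le fun s _ => (hξ s).comap_le
    have hξℱ : ∀ I, ∀ s ∈ I, Measurable[ℱ I] (ξ s) := fun I s hs => Measurable.of_comap_le
      (le_iSup₂ (f := fun s (_ : s ∈ I) =>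
        (inferInstance : MeasurableSpace (Fin N → ℝ)).comap (ξ s)) s hs)
    have hindep : Indep (ℱ (Set.Iic t)) (ℱ {t + 1}) P :=
      indep_iSup_of_disjoint (fun s => (hξ s).comap_le) hind (by simp)
    have hX : ∀ s ≤ t, Measurable[ℱ (Set.Iic t)] fun ω i => μ i + ξ s ω i := fun s hs =>
      (measurable_const_add μ).comp (hξℱ (Set.Iic t) s hs)
    -- Using the past σ-algebra instead of the ambient one makes the statistics, and hence the
    -- decision to pull, depend on the past alone.
    obtain ⟨hc, ht⟩ := @measurable_stats N K O σ α Ω (ℱ (Set.Iic t)) hO _ t hX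
    have hZ : Measurable[ℱ (Set.Iic t)] Z :=
      @measurable_expWeight N σ Ω (ℱ (Set.Iic t)) S i (hc i) (ht i) lam (μ i)
    have hA : MeasurableSet[ℱ (Set.Iic t)] A :=
      @measurableSet_mem_pulls N K O σ α Ω (ℱ (Set.Iic t)) hO S hc ht (t + 1) i
    have hW : Measurable[ℱ {t + 1}] W := by
      have hg : Measurable fun x : Fin N → ℝ =>
          ENNReal.ofReal (Real.exp (lam * x i - lam ^ 2 * σ ^ 2 / 2)) := by fun_prop
      exact hg.comp (hξℱ {t + 1} (t + 1) rfl)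
    -- A pull multiplies the weight by the fresh factor `W`; without a pull the weight is unchanged.
    have hstep : ∀ ω, expWeight σ lam (μ i) i
        (stats O σ α (fun s i => μ i + ξ s ω i) (t + 1)) =
          A.indicator Z ω * W ω + Aᶜ.indicator Z ω := by
      intro ω
      by_cases hω : ω ∈ A
      · have hω' : i ∈ pulls O σ α (t + 1) (stats O σ α (fun s i => μ i + ξ s ω i) t) := hω
        rw [Set.indicator_of_mem hω, Set.indicator_of_notMem (by simpa using hω), add_zero]
        simp only [Z, W, S, expWeight, stats_count_succ, stats_total_succ, if_pos hω']
        rw [← ENNReal.ofReal_mul (Real.exp_pos _).le, ← Real.exp_add]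
        congr 2
        push_cast
        ring
      · have hω' : i ∉ pulls O σ α (t + 1) (stats O σ α (fun s i => μ i + ξ s ω i) t) := hω
        rw [Set.indicator_of_notMem hω, Set.indicator_of_mem (by simpa using hω), zero_mul, zero_add]
        simp only [Z, S, expWeight, stats_count_succ, stats_total_succ, if_neg hω', add_zero]
    simp_rw [hstep]
    have hAZ : Measurable[ℱ (Set.Iic t)] (A.indicator Z) := hZ.indicator hA
    rw [lintegral_add_right _ ((hZ.mono (hℱ _) le_rfl).indicator ((hℱ _) _ hA).compl),
      lintegral_mul_eq_lintegral_mul_lintegral_of_independent_measurableSpace (hℱ _) (hℱ _) hindep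
        hAZ hW]
    calc (∫⁻ ω, A.indicator Z ω ∂P) * ∫⁻ ω, W ω ∂P + ∫⁻ ω, Aᶜ.indicator Z ω ∂P
        ≤ (∫⁻ ω, A.indicator Z ω ∂P) * 1 + ∫⁻ ω, Aᶜ.indicator Z ω ∂P := by
          gcongr
          exact lintegral_exp_noise_le (hsub (t + 1) i) lam
      _ = ∫⁻ ω, Z ω ∂P := by
          rw [mul_one, lintegral_indicator ((hℱ _) _ hA), lintegral_indicator ((hℱ _) _ hA).compl,
            lintegral_add_compl _ ((hℱ _) _ hA)]
      _ ≤ 1 := ih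

end Supermartingale

/-! ### Probability that a confidence interval misses. -/

/-- The confidence interval of arm `i` in round `t` misses the quality `m` of the arm. -/
def Misses (σ α : ℝ) (t : ℕ) (m : ℝ) (i : Fin N) (s : Stats N) : Prop :=
  radius σ α t s i < |s.total i / s.count i - m|

theorem measurableSet_misses {Ω : Type*} [MeasurableSpace Ω] {S : Ω → Stats N} {i : Fin N}
    (hc : Measurable fun ω => (S ω).count i) (ht : Measurable fun ω => (S ω).total i) (t : ℕ)
    (m : ℝ) : MeasurableSet {ω | Misses σ α t m i (S ω)} :=
  measurableSet_lt (measurable_radius hc t)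
    ((ht.div (measurable_from_top.comp hc)).sub_const m).norm

theorem lcb_le_and_le_ucb {t : ℕ} {m : ℝ} {i : Fin N} {s : Stats N} (h : ¬ Misses σ α t m i s) :
    lcb σ α t s i ≤ m ∧ m ≤ ucb σ α t s i := by
  have h' := abs_le.1 (not_lt.1 h)
  unfold lcb ucb
  constructor <;> linarith

/-- If a confidence interval built on `n` observations misses, then one of two exponential weights
is large. -/
theorem rpow_le_expWeight_of_misses (hσ : 0 < σ) (hα : 0 ≤ α) {t : ℕ} (ht : 1 ≤ t) {m : ℝ}
    {i : Fin N} {s : Stats N} (hs : 1 ≤ s.count i) (h : Misses σ α t m i s) :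
    ENNReal.ofReal ((t : ℝ) ^ α) ≤ expWeight σ (radius σ α t s i / σ ^ 2) m i s ∨
      ENNReal.ofReal ((t : ℝ) ^ α) ≤ expWeight σ (-(radius σ α t s i / σ ^ 2)) m i s := by
  have ht' : (1 : ℝ) ≤ t := by exact_mod_cast ht
  have hn : (0 : ℝ) < s.count i := by exact_mod_cast hs
  have hpow : (1 : ℝ) ≤ (t : ℝ) ^ α := Real.one_le_rpow ht' hα
  set r := radius σ α t s i with hr
  set n : ℝ := (s.count i : ℝ)
  have hr0 : 0 ≤ r := Real.sqrt_nonneg _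
  have hrsq : n * r ^ 2 = 2 * σ ^ 2 * Real.log ((t : ℝ) ^ α) := by
    have hlog := Real.log_nonneg hpow
    rw [hr, radius, Real.sq_sqrt (by positivity)]
    field_simp
    rfl
  -- The choice `r / σ ^ 2` maximizes `λ * n * r - λ ^ 2 * σ ^ 2 * n / 2` over `λ`; the maximum `n *
  -- r ^ 2 / (2 * σ ^ 2)` is `log (t ^ α)` by the definition of the radius.
  have key : ∀ x : ℝ, n * r ≤ x → (t : ℝ) ^ α ≤
      Real.exp (r / σ ^ 2 * x - (r / σ ^ 2) ^ 2 * σ ^ 2 / 2 * n) := by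
    intro x hx
    rw [← Real.log_le_iff_le_exp (by positivity)]
    have h₁ : r / σ ^ 2 * (n * r) ≤ r / σ ^ 2 * x := by gcongr
    have h₂ : r / σ ^ 2 * (n * r) - (r / σ ^ 2) ^ 2 * σ ^ 2 / 2 * n =
        n * r ^ 2 / (2 * σ ^ 2) := by field_simp; ring
    rw [hrsq, mul_div_cancel_left₀ _ (by positivity)] at h₂
    linarith
  have hmul : n * (s.total i / n - m) = s.total i - n * m := by field_simp
  unfold expWeight
  rcases lt_abs.1 h with h | h
  · left
    refine ENNReal.ofReal_le_ofReal (key _ ?_)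
    nlinarith
  · right
    refine ENNReal.ofReal_le_ofReal ((key (-(s.total i - n * m)) ?_).trans_eq ?_)
    · nlinarith
    · congr 1
      ring

section Deviation

variable {Ω : Type*} [mΩ : MeasurableSpace Ω] {P : Measure Ω} {ξ : ℕ → Ω → Fin N → ℝ}

/-- After the initial rounds, the confidence interval of an arm misses with small probability. -/
theorem measure_misses_le [IsProbabilityMeasure P] (hO : MeasurableOracle O) (hσ : 0 < σ)
    (hα : 0 ≤ α) (hξ : ∀ t, Measurable (ξ t)) (hind : iIndepFun ξ P)
    (hsub : ∀ t i, HasSubgaussianMGF (fun ω => ξ t ω i) (Real.toNNReal (σ ^ 2)) P)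
    (μ : Fin N → ℝ) (i : Fin N) {t : ℕ} (ht : N < t) :
    P {ω | Misses σ α t (μ i) i (stats O σ α (fun s i => μ i + ξ s ω i) (t - 1))} ≤
      ENNReal.ofReal (2 * (t : ℝ) ^ (1 - α)) := by
  have ht0 : (0 : ℝ) < t := by exact_mod_cast (by omega : 0 < t)
  have hpow : 0 < (t : ℝ) ^ α := Real.rpow_pos_of_pos ht0 α
  set S : Ω → Stats N := fun ω => stats O σ α (fun s i => μ i + ξ s ω i) (t - 1)
  -- The optimal parameter depends on the random pull count, while the supermartingale bound needs a
  -- fixed one. Hence one parameter per possible count `n`, and a union bound costing a factor `t -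
  -- 1`.
  let lam : ℕ → ℝ := fun n =>
    Real.sqrt (1 / (n : ℝ) * (2 * σ ^ 2 * Real.log ((t : ℝ) ^ α))) / σ ^ 2
  let E : ℝ → Set Ω := fun l => {ω | ENNReal.ofReal ((t : ℝ) ^ α) ≤ expWeight σ l (μ i) i (S ω)}
  have hE : ∀ l, P (E l) ≤ ENNReal.ofReal ((t : ℝ) ^ (-α)) := by
    intro l
    obtain ⟨hc, hm⟩ := measurable_stats (O := O) (σ := σ) (α := α) (t := t - 1) hO
      (X := fun s ω i => μ i + ξ s ω i) fun s _ => (measurable_const_add μ).comp (hξ s)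
    refine (meas_ge_le_lintegral_div (measurable_expWeight (hc i) (hm i) l (μ i)).aemeasurable
      (by simpa using hpow) ENNReal.ofReal_ne_top).trans ?_
    rw [Real.rpow_neg ht0.le, ENNReal.ofReal_inv_of_pos hpow, ← one_div]
    exact ENNReal.div_le_div_right (lintegral_expWeight_le hO hξ hind hsub μ l i (t - 1)) _
  have hsubset : {ω | Misses σ α t (μ i) i (S ω)} ⊆
      ⋃ n ∈ Finset.Icc 1 (t - 1), (E (lam n) ∪ E (-lam n)) := by
    intro ω hω
    have h₁ : 1 ≤ (S ω).count i := one_le_stats_count _ (by omega) i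
    have h₂ : (S ω).count i ≤ t - 1 := stats_count_le _ _ i
    exact Set.mem_biUnion (Finset.mem_Icc.2 ⟨h₁, h₂⟩)
      (rpow_le_expWeight_of_misses hσ hα (by omega) h₁ hω)
  calc P {ω | Misses σ α t (μ i) i (S ω)}
      ≤ ∑ n ∈ Finset.Icc 1 (t - 1), P (E (lam n) ∪ E (-lam n)) :=
        (measure_mono hsubset).trans (measure_biUnion_finset_le _ _)
    _ ≤ ∑ n ∈ Finset.Icc 1 (t - 1), ENNReal.ofReal (2 * (t : ℝ) ^ (-α)) := by
        refine Finset.sum_le_sum fun n _ => (measure_union_le _ _).trans ?_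
        rw [two_mul, ENNReal.ofReal_add (by positivity) (by positivity)]
        exact add_le_add (hE _) (hE _)
    _ = ENNReal.ofReal ((t - 1 : ℕ) * (2 * (t : ℝ) ^ (-α))) := by
        rw [Finset.sum_const, Nat.card_Icc, Nat.add_sub_cancel, nsmul_eq_mul,
          ENNReal.ofReal_mul (Nat.cast_nonneg (t - 1)), ENNReal.ofReal_natCast]
    _ ≤ ENNReal.ofReal (2 * (t : ℝ) ^ (1 - α)) := by
        refine ENNReal.ofReal_le_ofReal ?_
        have h₁ : ((t - 1 : ℕ) : ℝ) ≤ t := by exact_mod_cast Nat.sub_le t 1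
        have h₂ : (t : ℝ) ^ (1 - α) = t * (t : ℝ) ^ (-α) := by
          rw [sub_eq_add_neg, Real.rpow_add ht0, Real.rpow_one]
        rw [h₂]
        have := mul_le_mul_of_nonneg_right h₁ (by positivity : 0 ≤ 2 * (t : ℝ) ^ (-α))
        linarith

end Deviation

end FeasibilityULCB

/-! ### Counting bad rounds and the regret bound. -/

namespace FeasibilityULCB

variable {N K : ℕ} {O : Oracle N K} {σ α : ℝ}

/-- The number of observations of an arm after which its confidence interval is narrow up to
round `T`. -/
noncomputable def pullBound (N : ℕ) (α c σ gap : ℝ) (T : ℕ) : ℝ :=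
  2 * σ ^ 2 * α * Real.log T / (gap / (4 * c * N)) ^ 2

theorem pullBound_nonneg (hα : 0 ≤ α) (c gap : ℝ) (T : ℕ) : 0 ≤ pullBound N α c σ gap T := by
  have := Real.log_natCast_nonneg T
  unfold pullBound
  positivity

/-- Source of the constant: `32 = 2 * 4 ^ 2`, and `N ^ 3` is one factor for the arms and two from
the threshold `gap / (4 * c * N)`. -/
theorem mul_pullBound (N : ℕ) (α c σ gap : ℝ) (T : ℕ) :
    N * pullBound N α c σ gap T =
      32 * c ^ 2 * σ ^ 2 * α * (1 / gap ^ 2) * (N : ℝ) ^ 3 * Real.log T := by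
  rw [pullBound, div_pow, div_div_eq_mul_div]
  ring

/-- After the initial rounds, if the output is not `η`-stable, then some confidence interval misses
or some pulled arm has few observations. -/
theorem misses_or_pulled_of_output_notMem {M : Model N K} {c : ℝ} (hM : M.RewardRegular c)
    (hc : 0 < c) (hα : 0 ≤ α) {μ : Fin N → ℝ} {η ε Δ : ℝ}
    (hsep : M.Separated μ η Δ) (hΔ : η - Δ < ε) (hε : ε < η) (hne : (M.stableSet μ η).Nonempty)
    (hO : IsFeasibilityOracle M η ε O) (init : ℕ → Assignment N K) (X : ℕ → Fin N → ℝ)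
    {t T : ℕ} (ht : N < t) (htT : t ≤ T) (hout : output O σ α init X t ∉ M.stableSet μ η) :
    (∃ i, Misses σ α t (μ i) i (stats O σ α X (t - 1))) ∨
      ∃ i, i ∈ pulls O σ α t (stats O σ α X (t - 1)) ∧
        ((stats O σ α X (t - 1)).count i : ℝ) ≤ pullBound N α c σ (η - ε) T := by
  refine or_iff_not_imp_left.2 fun hmiss => ?_
  push Not at hmiss
  rw [output, if_neg ht.not_ge] at hout
  set s := stats O σ α X (t - 1)
  have h := M.lt_of_oracle_notMem hM hc hsep hΔ hne hO
    (fun i => (lcb_le_and_le_ucb (hmiss i)).1) (fun i => (lcb_le_and_le_ucb (hmiss i)).2) hout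
  have hwidth : ∀ i, ucb σ α t s i - lcb σ α t s i = 2 * radius σ α t s i := fun i => by
    unfold ucb lcb
    ring
  simp_rw [hwidth, ← Finset.mul_sum] at h
  rw [← mul_assoc, show 2 * c * 2 = 4 * c by ring] at h
  have hgap : 0 < η - ε := sub_pos.2 hε
  -- Pigeonhole over at most `N` pulled arms. In `4 * c`, one factor `2` comes from the two bundles
  -- of an agent, the other from width being twice the radius.
  obtain ⟨i, hi, hlt⟩ := exists_div_lt_of_lt_sum hgap (by positivity) h
  have hN : (0 : ℝ) < N := by exact_mod_cast i.pos
  refine ⟨i, by rwa [pulls, if_neg ht.not_ge], ?_⟩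
  exact count_le_of_lt_radius (by omega) htT hα (one_le_stats_count X (by omega) i)
    (by positivity) hlt

open Classical in
/-- On each sample path, the number of bad rounds is bounded by a deterministic quantity plus the
number of misses of confidence intervals. -/
theorem sum_indicator_output_le {Ω : Type*} {M : Model N K} {c : ℝ} (hM : M.RewardRegular c)
    (hc : 0 < c) (hα : 0 ≤ α) {μ : Fin N → ℝ} {η ε Δ : ℝ}
    (hsep : M.Separated μ η Δ) (hΔ : η - Δ < ε) (hε : ε < η) (hne : (M.stableSet μ η).Nonempty)
    (hO : IsFeasibilityOracle M η ε O) (init : ℕ → Assignment N K) (X : ℕ → Ω → Fin N → ℝ)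
    {T : ℕ} (hT : N < T) (ω : Ω) :
    ∑ t ∈ Finset.Icc 1 T,
        Set.indicator {ω' | output O σ α init (fun s => X s ω') t ∉ M.stableSet μ η}
          (1 : Ω → ENNReal) ω ≤
      ENNReal.ofReal (N + N * pullBound N α c σ (η - ε) T) + ∑ t ∈ Finset.Ioc N T, ∑ i,
        Set.indicator {ω' | Misses σ α t (μ i) i (stats O σ α (fun s => X s ω') (t - 1))}
          (1 : Ω → ENNReal) ω := by
  set B := pullBound N α c σ (η - ε) T with hB
  have hB0 : 0 ≤ B := pullBound_nonneg hα _ _ _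
  let bad : ℕ → ENNReal := fun t =>
    Set.indicator {ω' | output O σ α init (fun s => X s ω') t ∉ M.stableSet μ η} 1 ω
  let miss : ℕ → Fin N → ENNReal := fun t i =>
    Set.indicator {ω' | Misses σ α t (μ i) i (stats O σ α (fun s => X s ω') (t - 1))} 1 ω
  let wide : ℕ → Fin N → ℝ := fun t i =>
    if i ∈ pulls O σ α t (stats O σ α (fun s => X s ω) (t - 1)) ∧
      ((stats O σ α (fun s => X s ω) (t - 1)).count i : ℝ) ≤ B then 1 else 0
  have hwide : ∀ t i, 0 ≤ wide t i := fun t i => by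
    simp only [wide]
    split_ifs <;> norm_num
  have hbad1 : ∀ t, bad t ≤ 1 := fun t => Set.indicator_le_self' (fun _ _ => zero_le) ω
  have hround : ∀ t ∈ Finset.Ioc N T, bad t ≤
      ∑ i, ENNReal.ofReal (wide t i) + ∑ i, miss t i := by
    intro t ht
    obtain ⟨ht₁, ht₂⟩ := Finset.mem_Ioc.1 ht
    by_cases hout : output O σ α init (fun s => X s ω) t ∈ M.stableSet μ η
    · have : bad t = 0 := Set.indicator_of_notMem (s := {ω' | output O σ α init
        (fun s => X s ω') t ∉ M.stableSet μ η}) (fun h => h hout) _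
      rw [this]
      exact zero_le
    refine (hbad1 t).trans ?_
    rcases misses_or_pulled_of_output_notMem hM hc hα hsep hΔ hε hne hO init _ ht₁ ht₂ hout with
      ⟨i, hi⟩ | ⟨i, hi⟩
    · have : miss t i = 1 := Set.indicator_of_mem (s := {ω' | Misses σ α t (μ i) i
        (stats O σ α (fun s => X s ω') (t - 1))}) hi _
      exact (this.symm.trans_le (Finset.single_le_sum (fun _ _ => zero_le)
        (Finset.mem_univ i))).trans le_add_self
    · have : ENNReal.ofReal (wide t i) = 1 := by
        rw [show wide t i = 1 from if_pos hi, ENNReal.ofReal_one]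
      exact (this.symm.trans_le (Finset.single_le_sum (f := fun i => ENNReal.ofReal (wide t i))
        (fun _ _ => zero_le) (Finset.mem_univ i))).trans le_self_add
  have hsplit : Finset.Icc 1 T = Finset.Icc 1 N ∪ Finset.Ioc N T := by
    ext t
    simp only [Finset.mem_union, Finset.mem_Icc, Finset.mem_Ioc]
    omega
  -- The initial rounds are all counted as bad.
  have hinit : ∑ t ∈ Finset.Icc 1 N, bad t ≤ ENNReal.ofReal N :=
    (Finset.sum_le_sum fun t _ => hbad1 t).trans_eq (by simp)
  have hsum : ∑ t ∈ Finset.Ioc N T, ∑ i, ENNReal.ofReal (wide t i) ≤ ENNReal.ofReal (N * B) := by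
    rw [Finset.sum_comm]
    calc ∑ i, ∑ t ∈ Finset.Ioc N T, ENNReal.ofReal (wide t i)
        ≤ ∑ _i : Fin N, ENNReal.ofReal B := by
          refine Finset.sum_le_sum fun i _ => ?_
          rw [← ENNReal.ofReal_sum_of_nonneg fun t _ => hwide t i]
          exact ENNReal.ofReal_le_ofReal (sum_pulls_le _ i hB0 hT.le)
      _ = ENNReal.ofReal (N * B) := by
          rw [Finset.sum_const, Finset.card_univ, Fintype.card_fin, nsmul_eq_mul,
            ENNReal.ofReal_mul (Nat.cast_nonneg N), ENNReal.ofReal_natCast]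
  calc ∑ t ∈ Finset.Icc 1 T, bad t
      ≤ ∑ t ∈ Finset.Icc 1 N, bad t + ∑ t ∈ Finset.Ioc N T, bad t := by
        rw [hsplit, Finset.sum_union]
        refine Finset.disjoint_left.2 fun t h₁ h₂ => ?_
        have := (Finset.mem_Icc.1 h₁).2
        have := (Finset.mem_Ioc.1 h₂).1
        omega
    _ ≤ ENNReal.ofReal N + (ENNReal.ofReal (N * B) +
          ∑ t ∈ Finset.Ioc N T, ∑ i, miss t i) := by
        refine add_le_add hinit ((Finset.sum_le_sum hround).trans ?_)
        rw [Finset.sum_add_distrib]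
        exact add_le_add hsum le_rfl
    _ = _ := by rw [← add_assoc, ← ENNReal.ofReal_add (by positivity) (by positivity)]

/-- Summing the miss probabilities over rounds gives a convergent series because `1 - α < -1`, so
the total is linear in `N` and free of `T`. -/
theorem lintegral_misses_le {Ω : Type*} [MeasurableSpace Ω] {P : Measure Ω}
    [IsProbabilityMeasure P] (hO : MeasurableOracle O) (hσ : 0 < σ) (hα : 2 < α)
    {ξ : ℕ → Ω → Fin N → ℝ} (hξ : ∀ t, Measurable (ξ t)) (hind : iIndepFun ξ P)
    (hsub : ∀ t i, HasSubgaussianMGF (fun ω => ξ t ω i) (Real.toNNReal (σ ^ 2)) P)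
    (μ : Fin N → ℝ) (T : ℕ) :
    ∫⁻ ω, ∑ t ∈ Finset.Ioc N T, ∑ i, Set.indicator
      {ω' | Misses σ α t (μ i) i (stats O σ α (fun s i => μ i + ξ s ω' i) (t - 1))} 1 ω ∂P ≤
      ENNReal.ofReal (N * (2 * ∑' t : ℕ, (t : ℝ) ^ (1 - α))) := by
  have hmeas : ∀ t i, MeasurableSet
      {ω | Misses σ α t (μ i) i (stats O σ α (fun s i => μ i + ξ s ω i) (t - 1))} := by
    intro t i
    obtain ⟨hc, hm⟩ := measurable_stats (O := O) (σ := σ) (α := α) (t := t - 1) hO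
      (X := fun s ω i => μ i + ξ s ω i) fun s _ => (measurable_const_add μ).comp (hξ s)
    exact measurableSet_misses (hc i) (hm i) t (μ i)
  have hind' : ∀ t i, Measurable (Set.indicator
      {ω | Misses σ α t (μ i) i (stats O σ α (fun s i => μ i + ξ s ω i) (t - 1))}
      (1 : Ω → ENNReal)) := fun t i => measurable_one.indicator (hmeas t i)
  rw [lintegral_finsetSum _ fun t _ => Finset.measurable_sum _ fun i _ => hind' t i]
  have hnn : ∀ t : ℕ, 0 ≤ (t : ℝ) ^ (1 - α) := fun t => by positivity
  calc ∑ t ∈ Finset.Ioc N T, ∫⁻ ω, ∑ i, Set.indicator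
          {ω' | Misses σ α t (μ i) i (stats O σ α (fun s i => μ i + ξ s ω' i) (t - 1))} 1 ω ∂P
      ≤ ∑ t ∈ Finset.Ioc N T, ENNReal.ofReal (N * (2 * (t : ℝ) ^ (1 - α))) := by
        refine Finset.sum_le_sum fun t ht => ?_
        rw [lintegral_finsetSum _ fun i _ => hind' t i]
        refine (Finset.sum_le_sum fun i _ => ?_).trans_eq
          (b := ∑ _i : Fin N, ENNReal.ofReal (2 * (t : ℝ) ^ (1 - α))) ?_
        · rw [lintegral_indicator_one (hmeas t i)]
          exact measure_misses_le hO hσ (by linarith) hξ hind hsub μ i (Finset.mem_Ioc.1 ht).1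
        · rw [Finset.sum_const, Finset.card_univ, Fintype.card_fin, nsmul_eq_mul,
            ENNReal.ofReal_mul (Nat.cast_nonneg N), ENNReal.ofReal_natCast]
    _ = ENNReal.ofReal (N * (2 * ∑ t ∈ Finset.Ioc N T, (t : ℝ) ^ (1 - α))) := by
        rw [← ENNReal.ofReal_sum_of_nonneg fun t _ => by positivity, Finset.mul_sum,
          Finset.mul_sum]
    _ ≤ _ := by
        refine ENNReal.ofReal_le_ofReal ?_
        gcongr
        exact (Real.summable_nat_rpow.2 (by linarith)).sum_le_tsum _ fun t _ => hnn t

end FeasibilityULCB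

theorem theorem7 :
    ∃ (C₁ : ℝ → ℝ → ℝ → ℝ) (C₂ : ℝ → ℝ),
      ∀ (α c σ : ℝ), 2 < α → 0 < c → 0 < σ →
      ∀ (N K : ℕ) (M : FeasibilityULCB.Model N K) (μ : Fin N → ℝ) (η ε Δ : ℝ),
        M.RewardRegular c →
        0 < η → 0 < Δ → M.Separated μ η Δ → η - Δ < ε → ε < η →
        (M.stableSet μ η).Nonempty →
      ∀ (O : FeasibilityULCB.Oracle N K),
        FeasibilityULCB.IsFeasibilityOracle M η ε O → FeasibilityULCB.MeasurableOracle O →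
      ∀ (init : ℕ → FeasibilityULCB.Assignment N K)
        (Ω : Type*) [MeasurableSpace Ω] (P : Measure Ω) [IsProbabilityMeasure P]
        (ξ : ℕ → Ω → Fin N → ℝ),
        (∀ t, Measurable (ξ t)) →
        iIndepFun ξ P →
        (∀ t i, HasSubgaussianMGF (fun ω => ξ t ω i) (Real.toNNReal (σ ^ 2)) P) →
      ∀ T : ℕ, N < T →
        FeasibilityULCB.regret P O σ α init μ ξ (M.stableSet μ η) T ≤
          ENNReal.ofReal
            (C₁ α c σ * (1 / Δ ^ 2 + 1 / (η - ε) ^ 2) * (N : ℝ) ^ 3 * Real.log T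
              + N * C₂ α) := by
  -- In the second constant, `1` pays for the initial rounds and the series for misses; its term at
  -- `t = 0` is `0`, since the exponent is nonzero.
  refine ⟨fun α c σ => 32 * c ^ 2 * σ ^ 2 * α, fun α => 1 + 2 * ∑' t : ℕ, (t : ℝ) ^ (1 - α), ?_⟩
  intro α c σ hα hc hσ N K M μ η ε Δ hM _ _ hsep hΔ hε hne O hO hOm init Ω _ P _ ξ hξ hind hsub T hT
  have hα0 : 0 ≤ α := by linarith
  have hB := FeasibilityULCB.pullBound_nonneg (N := N) (σ := σ) hα0 c (η - ε) T
  have hlog := Real.log_natCast_nonneg T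
  have hsum : 0 ≤ ∑' t : ℕ, (t : ℝ) ^ (1 - α) := tsum_nonneg fun t => by positivity
  refine (lintegral_mono fun ω => FeasibilityULCB.sum_indicator_output_le hM hc hα0 hsep hΔ hε hne
    hO init (fun s ω i => μ i + ξ s ω i) hT ω).trans ?_
  rw [lintegral_add_left measurable_const, lintegral_const, measure_univ, mul_one]
  refine (add_le_add le_rfl
    (FeasibilityULCB.lintegral_misses_le hOm hσ hα hξ hind hsub μ T)).trans ?_
  rw [← ENNReal.ofReal_add (by positivity) (by positivity), FeasibilityULCB.mul_pullBound]
  refine ENNReal.ofReal_le_ofReal ?_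
  -- The argument yields the bound with `1 / (η - ε) ^ 2` alone; the `1 / Δ ^ 2` term is nonnegative
  -- slack.
  have hextra : 0 ≤ 32 * c ^ 2 * σ ^ 2 * α * (1 / Δ ^ 2) * (N : ℝ) ^ 3 * Real.log T := by
    positivity
  linarith
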